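/- Let $n\ge 0$. For $\theta\in\mathbb{R}^n$ and a real symmetric positive definite $n\times n$ matrix $\Sigma$, let $N(\theta,\Sigma)$ denote the Gaussian probability measure on $\mathbb{R}^n$ with mean vector $\theta$ and covariance matrix $\Sigma$. Let $T$ be a Borel automorphism of $\mathbb{R}^n$, i.e. a bijection of $\mathbb{R}^n$ onto itself such that both $T$ and $T^{-1}$ are Borel measurable, and let $\theta_0,\theta_1,\dots,\theta_n\in\mathbb{R}^n$ be such that $\{\theta_j-\theta_0 : 1\le j\le n\}$ is a basis of $\mathbb{R}^n$. Suppose that there exist a nonsingular (i.e. positive definite) covariance matrix $\Sigma$, vectors $\varphi_0,\dots,\varphi_n\in\mathbb{R}^n$ and positive definite matrices $\Psi_0,\dots,\Psi_n$ such that the image measures under $T$ satisfy $$N(\theta_j,\Sigma)\,T^{-1}=N(\varphi_j,\Psi_j),\qquad 0\le j\le n.$$ Then $T$ is an affine automorphism; that is, there exist a nonsingular real $n\times n$ matrix $A$ and a vector $a\in\mathbb{R}^n$ such that $T(x)=Ax+a$ for Lebesgue-almost every $x\in\mathbb{R}^n$. -/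

import Mathlib

open MeasureTheory

/-- A map `T` of `ℝⁿ` is an affine automorphism if it is Borel measurable and there are a nonsingular
real matrix `A` and a vector `a` with `T x = A x + a` for Lebesgue-almost every `x`. -/
def IsAffineAutomorphism {n : ℕ} (T : EuclideanSpace ℝ (Fin n) → EuclideanSpace ℝ (Fin n)) : Prop :=
  Measurable T ∧
    ∃ (A : Matrix.GeneralLinearGroup (Fin n) ℝ) (a : EuclideanSpace ℝ (Fin n)),
      ∀ᵐ x ∂(volume : Measure (EuclideanSpace ℝ (Fin n))),
        T x = WithLp.toLp 2 (Matrix.mulVec (A : Matrix (Fin n) (Fin n) ℝ) (WithLp.ofLp x)) + a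

open scoped ENNReal RealInnerProductSpace

/-! Log-likelihood ratios correspond under `T`. On the source side the covariance is shared, so the
log-ratio of the `j`th to the zeroth Gaussian is affine in `x` and has finite exponential moments of
every order, as completing the square shows. By transport the same holds on the target side, which
forces the quadratic forms of all `Ψ j` to agree: otherwise some tilt makes the exponent strictly
convex along a line and the integral diverges. Both log-ratios are then affine, so `n` affine
functionals of `T x` equal affine functionals of `x` almost everywhere; the latter are independent
because the `θ j - θ 0` form a basis, and linear algebra recovers `T`. -/

/-- Pushing a measure with density forward along a measurable equivalence. -/
theorem MeasurableEquiv.map_withDensity_comp_symm {α β : Type*} [MeasurableSpace α]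
    [MeasurableSpace β] (e : α ≃ᵐ β) (μ : Measure α) (f : α → ℝ≥0∞) :
    (μ.withDensity f).map e = (μ.map e).withDensity (f ∘ e.symm) := by
  ext s hs
  rw [e.map_apply, withDensity_apply _ (e.measurable hs), withDensity_apply _ hs,
    e.restrict_map, lintegral_map_equiv]
  simp

/-! ### Gaussian densities -/

section StdGaussian

variable {E : Type*} [NormedAddCommGroup E] [InnerProductSpace ℝ E] [FiniteDimensional ℝ E]
  [MeasurableSpace E] [BorelSpace E]

/-- The standard Gaussian measure has a density proportional to `exp (-‖x‖ ^ 2 / 2)`. -/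
theorem exists_stdGaussian_eq_withDensity :
    ∃ K : ℝ, 0 < K ∧ ProbabilityTheory.stdGaussian E =
      (volume : Measure E).withDensity fun x ↦ ENNReal.ofReal (K * Real.exp (-‖x‖ ^ 2 / 2)) := by
  have hint : Integrable (fun x : E ↦ Real.exp (-‖x‖ ^ 2 / 2)) := by
    have h := (GaussianFourier.integrable_cexp_neg_mul_sq_norm_add (V := E) (b := (1 / 2 : ℝ))
      (by norm_num) 0 0).norm
    refine h.congr (.of_forall fun x ↦ ?_)
    simp only [Complex.norm_exp]
    congr 1
    rw [zero_mul, add_zero, ← Complex.ofReal_pow, ← Complex.ofReal_neg, ← Complex.ofReal_mul,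
      Complex.ofReal_re]
    ring
  let K : ℝ := ((2 * Real.pi) ^ (Module.finrank ℝ E / 2 : ℝ))⁻¹
  have hK : 0 < K := by positivity
  -- Finiteness suffices to compare characteristic functions; total mass one then comes for free.
  have hfin : IsFiniteMeasure ((volume : Measure E).withDensity
      fun x ↦ ENNReal.ofReal (K * Real.exp (-‖x‖ ^ 2 / 2))) :=
    isFiniteMeasure_withDensity_ofReal (hint.const_mul K).2
  refine ⟨K, hK, Measure.ext_of_charFun ?_⟩
  ext t
  rw [ProbabilityTheory.charFun_stdGaussian, charFun_apply,
    integral_withDensity_eq_integral_toReal_smul (by fun_prop) (by simp)]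
  have h := GaussianFourier.integral_cexp_neg_mul_sq_norm_add (V := E) (b := (1 / 2 : ℝ))
    (by norm_num) Complex.I t
  have hc : (Real.pi / (1 / 2 : ℝ) : ℂ) ^ (Module.finrank ℝ E / 2 : ℂ) = ((K⁻¹ : ℝ) : ℂ) := by
    simp only [K, inv_inv]
    rw [Complex.ofReal_cpow (by positivity)]
    push_cast
    congr 1
    ring
  rw [hc] at h
  have h2 : ∀ x : E, (ENNReal.ofReal (K * Real.exp (-‖x‖ ^ 2 / 2))).toReal •
      Complex.exp (⟪x, t⟫ * Complex.I) =
      (K : ℂ) * Complex.exp (-((1 / 2 : ℝ) : ℂ) * ‖x‖ ^ 2 + Complex.I * ⟪t, x⟫) := by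
    intro x
    rw [ENNReal.toReal_ofReal (by positivity), Complex.real_smul, Complex.ofReal_mul,
      Complex.ofReal_exp, mul_assoc, ← Complex.exp_add, real_inner_comm]
    congr 2
    push_cast
    ring
  simp_rw [h2]
  rw [integral_const_mul, h, ← mul_assoc, ← Complex.ofReal_mul, mul_inv_cancel₀ hK.ne']
  simp only [Complex.I_sq, Complex.ofReal_one, one_mul]
  congr 1
  push_cast
  ring

end StdGaussian

/-- A nondegenerate Gaussian measure has a density proportional to `exp (-‖B (x - m)‖ ^ 2 / 2)`,
where `B` and the constant of proportionality depend on the covariance matrix only. -/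
theorem exists_multivariateGaussian_eq_withDensity {ι : Type*} [Fintype ι] [DecidableEq ι]
    {S : Matrix ι ι ℝ} (hS : S.PosDef) :
    ∃ (B : EuclideanSpace ℝ ι ≃L[ℝ] EuclideanSpace ℝ ι) (K : ℝ), 0 < K ∧
      ∀ m, ProbabilityTheory.multivariateGaussian m S =
        (volume : Measure (EuclideanSpace ℝ ι)).withDensity
          fun x ↦ ENNReal.ofReal (K * Real.exp (-‖B (x - m)‖ ^ 2 / 2)) := by
  open scoped MatrixOrder in
  obtain ⟨K, hK, hstd⟩ := exists_stdGaussian_eq_withDensity (E := EuclideanSpace ℝ ι)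
  have hsq : CFC.sqrt S * CFC.sqrt S = S := CFC.sqrt_mul_sqrt_self _ hS.posSemidef.nonneg
  have hu : IsUnit (CFC.sqrt S) := isUnit_of_mul_isUnit_left (hsq ▸ hS.isUnit)
  have hu' : IsUnit (Matrix.toEuclideanCLM (𝕜 := ℝ) (CFC.sqrt S)) := hu.map _
  obtain ⟨u, hu⟩ := hu'
  let A : EuclideanSpace ℝ ι ≃L[ℝ] EuclideanSpace ℝ ι := ContinuousLinearEquiv.unitsEquiv ℝ _ u
  have hA : ∀ x, A x = Matrix.toEuclideanCLM (𝕜 := ℝ) (CFC.sqrt S) x := fun x ↦ by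
    rw [← hu]; rfl
  have hdet : LinearMap.det (A : EuclideanSpace ℝ ι →ₗ[ℝ] EuclideanSpace ℝ ι) ≠ 0 :=
    (LinearEquiv.isUnit_det' A.toLinearEquiv).ne_zero
  set c : ℝ := |(LinearMap.det (A : EuclideanSpace ℝ ι →ₗ[ℝ] EuclideanSpace ℝ ι))⁻¹| with hc
  have hcpos : 0 < c := abs_pos.2 (inv_ne_zero hdet)
  refine ⟨A.symm, c * K, by positivity, fun m ↦ ?_⟩
  let e : EuclideanSpace ℝ ι ≃ᵐ EuclideanSpace ℝ ι :=
    (A.toHomeomorph.trans (Homeomorph.addLeft m)).toMeasurableEquiv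
  have he : (fun x ↦ m + Matrix.toEuclideanCLM (𝕜 := ℝ) (CFC.sqrt S) x) = e := by
    ext1 x; rw [← hA]; rfl
  have hes : ∀ y, e.symm y = A.symm (y - m) := fun y ↦ by
    rw [MeasurableEquiv.symm_apply_eq]
    change y = m + A (A.symm (y - m))
    simp
  have hvol : (volume : Measure (EuclideanSpace ℝ ι)).map e = ENNReal.ofReal c • volume := by
    have : (e : EuclideanSpace ℝ ι → EuclideanSpace ℝ ι) =
        (fun x ↦ m + x) ∘ (A : EuclideanSpace ℝ ι →ₗ[ℝ] EuclideanSpace ℝ ι) := rfl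
    rw [this, ← Measure.map_map (by fun_prop)
        (by exact A.continuous.measurable),
      Measure.map_linearMap_addHaar_eq_smul_addHaar _ hdet, Measure.map_smul,
      map_add_left_eq_self]
  rw [ProbabilityTheory.multivariateGaussian, he, hstd, e.map_withDensity_comp_symm, hvol,
    withDensity_smul_measure, ← withDensity_smul _ (by fun_prop)]
  congr 1
  ext1 y
  simp only [Pi.smul_apply, Function.comp_apply, hes, smul_eq_mul]
  rw [← ENNReal.ofReal_mul hcpos.le, mul_assoc]

/-! ### Likelihood ratios and exponential moments -/

/-- If `T` maps two measures with densities with respect to `μ` to two measures with densities with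
respect to `ν`, then the likelihood ratios correspond under `T`, here in cross-multiplied form. -/
theorem MeasurableEquiv.ae_mul_comp_eq_of_map_withDensity {α β : Type*} [MeasurableSpace α]
    [MeasurableSpace β] (T : α ≃ᵐ β) {μ : Measure α} [SigmaFinite μ] {ν : Measure β}
    {p p' : α → ℝ≥0∞} {q q' : β → ℝ≥0∞} (hp : Measurable p) (hp' : Measurable p')
    (hq : Measurable q) (hq' : Measurable q')
    (h : (μ.withDensity p).map T = ν.withDensity q)
    (h' : (μ.withDensity p').map T = ν.withDensity q') :
    ∀ᵐ x ∂μ, p x * q' (T x) = p' x * q (T x) := by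
  have hσ : SigmaFinite (μ.map T) := T.sigmaFinite_map
  rw [T.map_withDensity_comp_symm] at h h'
  have hpT : Measurable (p ∘ T.symm) := hp.comp T.symm.measurable
  have hpT' : Measurable (p' ∘ T.symm) := hp'.comp T.symm.measurable
  -- Both sides equal `ν.withDensity (q * q')`, so no relation between `μ.map T` and `ν` is needed.
  have key : (μ.map T).withDensity ((p ∘ T.symm) * q') =
      (μ.map T).withDensity ((p' ∘ T.symm) * q) := by
    rw [withDensity_mul _ hpT hq', withDensity_mul _ hpT' hq, h, h',
      ← withDensity_mul _ hq hq', ← withDensity_mul _ hq' hq, mul_comm]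
  rw [withDensity_eq_iff_of_sigmaFinite (by fun_prop) (by fun_prop)] at key
  filter_upwards [ae_of_ae_map T.measurable.aemeasurable key] with x hx
  simpa using hx

section NormedSpace

variable {E : Type*} [NormedAddCommGroup E] [MeasurableSpace E] [BorelSpace E]

/-- The exponential of a function with second differences bounded below by a positive constant in
some direction is not integrable with respect to a translation invariant measure. -/
theorem lintegral_exp_eq_top_of_second_difference {μ : Measure E} [μ.IsAddHaarMeasure]
    {e : E → ℝ} (he : Measurable e) {v : E} {a : ℝ} (ha : 0 < a)
    (h : ∀ y, 2 * e y + 2 * a ≤ e (y + v) + e (y - v)) :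
    ∫⁻ y, ENNReal.ofReal (Real.exp (e y)) ∂μ = ∞ := by
  by_contra hfin
  set J := ∫⁻ y, ENNReal.ofReal (Real.exp (e y)) ∂μ with hJ
  have hJ0 : J ≠ 0 := by
    rw [hJ, Ne, lintegral_eq_zero_iff (by fun_prop)]
    intro h0
    have : ∀ᵐ _ ∂μ, False := by
      filter_upwards [h0] with y hy
      exact absurd hy (by simp [Real.exp_pos])
    exact NeZero.ne μ (by simpa using this)
  have hadd : ∫⁻ y, ENNReal.ofReal (Real.exp (e (y + v))) ∂μ = J :=
    lintegral_add_right_eq_self (fun y ↦ ENNReal.ofReal (Real.exp (e y))) v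
  have hsub : ∫⁻ y, ENNReal.ofReal (Real.exp (e (y - v))) ∂μ = J :=
    lintegral_sub_right_eq_self (fun y ↦ ENNReal.ofReal (Real.exp (e y))) v
  -- AM-GM turns the hypothesis into a pointwise bound between exponentials; translation invariance
  -- integrates it.
  have hle : ENNReal.ofReal (2 * Real.exp a) * J ≤ J + J := by
    nth_rewrite 2 [← hadd]
    rw [← hsub, ← lintegral_add_left (by fun_prop), hsub, hJ,
      ← lintegral_const_mul _ (by fun_prop)]
    refine lintegral_mono fun y ↦ ?_
    rw [← ENNReal.ofReal_mul (by positivity), ← ENNReal.ofReal_add (by positivity) (by positivity)]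
    refine ENNReal.ofReal_le_ofReal ?_
    have h1 : Real.exp (a + e y) ≤ Real.exp ((e (y + v) + e (y - v)) / 2) :=
      Real.exp_le_exp.2 (by linarith [h y])
    have h2 : Real.exp ((e (y + v) + e (y - v)) / 2) =
        Real.exp (e (y + v) / 2) * Real.exp (e (y - v) / 2) := by
      rw [← Real.exp_add]; ring_nf
    have h3 : ∀ z : ℝ, Real.exp z = Real.exp (z / 2) ^ 2 := fun z ↦ by
      rw [← Real.exp_nat_mul]; ring_nf
    rw [Real.exp_add] at h1
    rw [h3 (e (y + v)), h3 (e (y - v))]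
    nlinarith [sq_nonneg (Real.exp (e (y + v) / 2) - Real.exp (e (y - v) / 2))]
  rw [← two_mul] at hle
  have h2 := (ENNReal.mul_le_mul_iff_left hJ0 hfin).1 hle
  have : 2 * Real.exp a ≤ 2 := by
    have h4 := ENNReal.ofReal_le_ofReal_iff (p := 2 * Real.exp a) (q := 2) (by norm_num)
    exact h4.1 (by simpa using h2)
  linarith [Real.one_lt_exp_iff.2 ha]

end NormedSpace

section InnerProductSpace

variable {E : Type*} [NormedAddCommGroup E] [InnerProductSpace ℝ E]

/-- If all exponential moments of the log-likelihood ratio of two Gaussian densities are finite,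
then their quadratic parts agree. -/
theorem norm_sq_eq_of_forall_lintegral_exp_ne_top [MeasurableSpace E] [BorelSpace E]
    {μ : Measure E} [μ.IsAddHaarMeasure]
    (B C : E →L[ℝ] E) (m m' : E)
    (h : ∀ t : ℝ, ∫⁻ y, ENNReal.ofReal (Real.exp (t * (‖C (y - m')‖ ^ 2 - ‖B (y - m)‖ ^ 2) +
      -‖B (y - m)‖ ^ 2 / 2)) ∂μ ≠ ∞) (v : E) :
    ‖C v‖ ^ 2 = ‖B v‖ ^ 2 := by
  by_contra hne
  have hD : ‖C v‖ ^ 2 - ‖B v‖ ^ 2 ≠ 0 := sub_ne_zero.2 hne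
  have par : ∀ (A : E →L[ℝ] E) (y w : E),
      ‖A (y + v - w)‖ ^ 2 + ‖A (y - v - w)‖ ^ 2 = 2 * ‖A (y - w)‖ ^ 2 + 2 * ‖A v‖ ^ 2 := by
    intro A y w
    rw [show y + v - w = (y - w) + v by abel, show y - v - w = (y - w) - v by abel,
      map_add, map_sub A (y - w)]
    have := parallelogram_law_with_norm ℝ (A (y - w)) (A v)
    nlinarith
  -- This `t`, possibly negative, makes the second difference of the exponent along `v` exactly `2`.
  refine h ((‖B v‖ ^ 2 / 2 + 1) / (‖C v‖ ^ 2 - ‖B v‖ ^ 2))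
    (lintegral_exp_eq_top_of_second_difference (by fun_prop) (v := v) one_pos fun y ↦ ?_)
  set t := (‖B v‖ ^ 2 / 2 + 1) / (‖C v‖ ^ 2 - ‖B v‖ ^ 2)
  have ht : t * (‖C v‖ ^ 2 - ‖B v‖ ^ 2) = ‖B v‖ ^ 2 / 2 + 1 := div_mul_cancel₀ _ hD
  have h1 := par C y m'
  have h2 := par B y m
  linear_combination (-2) * ht - t * h1 + (t + 1 / 2) * h2

/-- Completing the square in an exponentially tilted Gaussian density. -/
theorem mul_sub_add_neg_div_two_eq (B : E →L[ℝ] E) (x m m' : E) (t : ℝ) :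
    t * (‖B (x - m')‖ ^ 2 - ‖B (x - m)‖ ^ 2) + -‖B (x - m)‖ ^ 2 / 2 =
      -‖B (x - (m - (2 * t) • (m' - m)))‖ ^ 2 / 2 + (2 * t ^ 2 + t) * ‖B (m' - m)‖ ^ 2 := by
  rw [show x - m' = (x - m) - (m' - m) by abel,
    show x - (m - (2 * t) • (m' - m)) = (x - m) + (2 * t) • (m' - m) by abel,
    map_sub, map_add, map_smul, norm_sub_sq_real, norm_add_sq_real, norm_smul, inner_smul_right,
    mul_pow, Real.norm_eq_abs, sq_abs]
  ring

/-- If `T` maps two Gaussian measures with the same covariance matrix to Gaussian measures, then an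
affine functional of `T x` agrees almost everywhere with an affine functional of `x`. -/
theorem exists_ae_inner_eq_of_map_gaussian_density [MeasurableSpace E] [BorelSpace E]
    [FiniteDimensional ℝ E] (T : E ≃ᵐ E) (B B₀ B₁ : E →L[ℝ] E) {K K₀ K₁ : ℝ} (hK : 0 < K)
    (hK₀ : 0 < K₀) (hK₁ : 0 < K₁) (m₀ m₁ m₀' m₁' : E)
    (hfin : ∀ m, ∫⁻ x : E, ENNReal.ofReal (K * Real.exp (-‖B (x - m)‖ ^ 2 / 2)) ≠ ∞)
    (h₀ : ((volume : Measure E).withDensity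
        fun x ↦ ENNReal.ofReal (K * Real.exp (-‖B (x - m₀)‖ ^ 2 / 2))).map T =
      volume.withDensity fun y ↦ ENNReal.ofReal (K₀ * Real.exp (-‖B₀ (y - m₀')‖ ^ 2 / 2)))
    (h₁ : ((volume : Measure E).withDensity
        fun x ↦ ENNReal.ofReal (K * Real.exp (-‖B (x - m₁)‖ ^ 2 / 2))).map T =
      volume.withDensity fun y ↦ ENNReal.ofReal (K₁ * Real.exp (-‖B₁ (y - m₁')‖ ^ 2 / 2))) :
    ∃ c : ℝ, ∀ᵐ x : E, ⟪B₀ (T x), B₀ (m₁' - m₀')⟫ = ⟪B x, B (m₁ - m₀)⟫ + c := by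
  set k : ℝ := 2 * (Real.log K₁ - Real.log K₀) with hk
  have hrel : ∀ᵐ x : E, ‖B₁ (T x - m₁')‖ ^ 2 - ‖B₀ (T x - m₀')‖ ^ 2 =
      ‖B (x - m₁)‖ ^ 2 - ‖B (x - m₀)‖ ^ 2 + k := by
    filter_upwards [T.ae_mul_comp_eq_of_map_withDensity (by fun_prop) (by fun_prop) (by fun_prop)
      (by fun_prop) h₀ h₁] with x hx
    rw [← ENNReal.ofReal_mul (by positivity), ← ENNReal.ofReal_mul (by positivity),
      ENNReal.ofReal_eq_ofReal_iff (by positivity) (by positivity)] at hx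
    have hlog := congrArg Real.log hx
    rw [Real.log_mul (by positivity) (by positivity), Real.log_mul (by positivity) (by positivity),
      Real.log_mul (by positivity) (by positivity), Real.log_mul (by positivity) (by positivity),
      Real.log_mul (by positivity) (by positivity), Real.log_mul (by positivity) (by positivity),
      Real.log_exp, Real.log_exp, Real.log_exp, Real.log_exp] at hlog
    linarith
  have hmom : ∀ t : ℝ, ∫⁻ y : E, ENNReal.ofReal (Real.exp
      (t * (‖B₁ (y - m₁')‖ ^ 2 - ‖B₀ (y - m₀')‖ ^ 2) + -‖B₀ (y - m₀')‖ ^ 2 / 2)) ≠ ∞ := by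
    intro t
    set f : E → ℝ≥0∞ := fun y ↦ ENNReal.ofReal
      (Real.exp (t * (‖B₁ (y - m₁')‖ ^ 2 - ‖B₀ (y - m₀')‖ ^ 2))) with hf
    have hfm : Measurable f := by fun_prop
    have hy : ∫⁻ y, f y ∂(volume.withDensity
          fun y ↦ ENNReal.ofReal (K₀ * Real.exp (-‖B₀ (y - m₀')‖ ^ 2 / 2))) =
        ENNReal.ofReal K₀ * ∫⁻ y : E, ENNReal.ofReal (Real.exp
          (t * (‖B₁ (y - m₁')‖ ^ 2 - ‖B₀ (y - m₀')‖ ^ 2) + -‖B₀ (y - m₀')‖ ^ 2 / 2)) := by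
      rw [lintegral_withDensity_eq_lintegral_mul _ (by fun_prop) hfm,
        ← lintegral_const_mul _ (by fun_prop)]
      refine lintegral_congr fun y ↦ ?_
      rw [Pi.mul_apply, hf, ← ENNReal.ofReal_mul (by positivity),
        ← ENNReal.ofReal_mul (by positivity), Real.exp_add]
      congr 1
      ring
    -- Pulled back by `T`, the tilt of the Gaussian at `m₀` is a multiple of the one at `m₀ - 2t(m₁
    -- - m₀)`.
    have hx : ∫⁻ y, f y ∂(volume.withDensity
          fun y ↦ ENNReal.ofReal (K₀ * Real.exp (-‖B₀ (y - m₀')‖ ^ 2 / 2))) =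
        ENNReal.ofReal (Real.exp (t * k + (2 * t ^ 2 + t) * ‖B (m₁ - m₀)‖ ^ 2)) *
          ∫⁻ x : E, ENNReal.ofReal
            (K * Real.exp (-‖B (x - (m₀ - (2 * t) • (m₁ - m₀)))‖ ^ 2 / 2)) := by
      rw [← h₀, lintegral_map_equiv,
        lintegral_withDensity_eq_lintegral_mul _ (by fun_prop)
          (show Measurable fun x ↦ f (T x) from hfm.comp T.measurable),
        ← lintegral_const_mul _ (by fun_prop)]
      refine lintegral_congr_ae ?_
      filter_upwards [hrel] with x hx
      rw [Pi.mul_apply, hf]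
      simp only [hx]
      rw [← ENNReal.ofReal_mul (by positivity), ← ENNReal.ofReal_mul (by positivity), mul_assoc,
        mul_left_comm _ K, ← Real.exp_add, ← Real.exp_add]
      congr 3
      linear_combination mul_sub_add_neg_div_two_eq B x m₀ m₁ t
    intro htop
    rw [hy, htop, ENNReal.mul_top (by simpa using hK₀)] at hx
    exact ENNReal.mul_ne_top ENNReal.ofReal_ne_top (hfin _) hx.symm
  have hnorm := norm_sq_eq_of_forall_lintegral_exp_ne_top B₀ B₁ m₀' m₁' hmom
  refine ⟨(‖B m₀‖ ^ 2 - ‖B m₁‖ ^ 2 - k + ‖B₀ m₁'‖ ^ 2 - ‖B₀ m₀'‖ ^ 2) / 2, ?_⟩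
  filter_upwards [hrel] with x hx
  rw [hnorm] at hx
  simp only [map_sub, norm_sub_sq_real, inner_sub_right] at hx ⊢
  linarith

end InnerProductSpace

/-! ### Recovering the affine map -/

/-- If the composition of a map `T` with a linear map agrees almost everywhere with an affine
bijection, then `T` agrees almost everywhere with an affine automorphism. -/
theorem exists_linearEquiv_ae_eq_of_ae_comp_eq {E F : Type*} [NormedAddCommGroup E]
    [NormedSpace ℝ E] [FiniteDimensional ℝ E] [MeasurableSpace E]
    [NormedAddCommGroup F] [NormedSpace ℝ F] {μ : Measure E} [μ.IsOpenPosMeasure]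
    (T : E → E) (G : E →ₗ[ℝ] F) (L : E ≃ₗ[ℝ] F) (c : F) (h : ∀ᵐ x ∂μ, G (T x) = L x + c) :
    ∃ (A : E ≃ₗ[ℝ] E) (a : E), ∀ᵐ x ∂μ, T x = A x + a := by
  have : FiniteDimensional ℝ F := L.finiteDimensional
  have hcont : Continuous fun x ↦ L x + c :=
    (LinearMap.continuous_of_finiteDimensional (L : E →ₗ[ℝ] F)).add continuous_const
  have hclosed : IsClosed {x | L x + c ∈ G.range} :=
    (Submodule.closed_of_finiteDimensional G.range).preimage hcont
  -- A closed set of full measure is everything, so `G` is onto, and bijective by dimension.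
  have hdense : Dense {x | L x + c ∈ G.range} :=
    Measure.dense_of_ae (h.mono fun x hx ↦ ⟨T x, hx⟩)
  have huniv : {x | L x + c ∈ G.range} = Set.univ := by
    rw [← hclosed.closure_eq, hdense.closure_eq]
  have hsurj : Function.Surjective G := fun z ↦ by
    have : L.symm (z - c) ∈ {x | L x + c ∈ G.range} := huniv ▸ Set.mem_univ _
    simpa using this
  have hinj : Function.Injective G :=
    (LinearMap.injective_iff_surjective_of_finrank_eq_finrank L.finrank_eq).2 hsurj
  let G' := LinearEquiv.ofBijective G ⟨hinj, hsurj⟩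
  refine ⟨L.trans G'.symm, G'.symm c, h.mono fun x hx ↦ ?_⟩
  rw [LinearEquiv.trans_apply, ← map_add, LinearEquiv.eq_symm_apply]
  exact hx

theorem corollary3p2 (n : ℕ)
    (T : EuclideanSpace ℝ (Fin n) ≃ᵐ EuclideanSpace ℝ (Fin n))
    (θ : Fin (n + 1) → EuclideanSpace ℝ (Fin n))
    (b : Module.Basis (Fin n) ℝ (EuclideanSpace ℝ (Fin n)))
    (hb : ∀ j : Fin n, b j = θ j.succ - θ 0)
    (S : Matrix (Fin n) (Fin n) ℝ) (hS : S.PosDef)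
    (φ : Fin (n + 1) → EuclideanSpace ℝ (Fin n))
    (Ψ : Fin (n + 1) → Matrix (Fin n) (Fin n) ℝ) (hΨ : ∀ j, (Ψ j).PosDef)
    (hT : ∀ j, Measure.map T (ProbabilityTheory.multivariateGaussian (θ j) S) =
      ProbabilityTheory.multivariateGaussian (φ j) (Ψ j)) :
    IsAffineAutomorphism T := by
  obtain ⟨B, K, hK, hB⟩ := exists_multivariateGaussian_eq_withDensity hS
  choose C k hk hC using fun j ↦ exists_multivariateGaussian_eq_withDensity (hΨ j)
  have hfin (m : EuclideanSpace ℝ (Fin n)) : ∫⁻ x : EuclideanSpace ℝ (Fin n),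
      ENNReal.ofReal (K * Real.exp (-‖B (x - m)‖ ^ 2 / 2)) ≠ ∞ := by
    have h := measure_ne_top (ProbabilityTheory.multivariateGaussian m S) Set.univ
    rwa [hB, withDensity_apply _ .univ, setLIntegral_univ] at h
  have hmap (j : Fin (n + 1)) := hT j
  simp only [hB, hC] at hmap
  choose c hc using fun j : Fin n ↦ exists_ae_inner_eq_of_map_gaussian_density T
    (B : EuclideanSpace ℝ (Fin n) →L[ℝ] EuclideanSpace ℝ (Fin n)) (C 0) (C j.succ) hK (hk 0)
    (hk j.succ) (θ 0) (θ j.succ) (φ 0) (φ j.succ) hfin (hmap 0) (hmap j.succ)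
  let G : EuclideanSpace ℝ (Fin n) →ₗ[ℝ] (Fin n → ℝ) := LinearMap.pi fun j ↦
    (innerₗ _ (C 0 (φ j.succ - φ 0))) ∘ₗ (C 0).toLinearEquiv.toLinearMap
  let L₀ : EuclideanSpace ℝ (Fin n) →ₗ[ℝ] (Fin n → ℝ) := LinearMap.pi fun j ↦
    (innerₗ _ (B (θ j.succ - θ 0))) ∘ₗ B.toLinearEquiv.toLinearMap
  -- If `L₀ x = 0`, then `B x` is orthogonal to the image under `B` of the basis `b`.
  have hL₀ : Function.Injective L₀ := by
    refine (injective_iff_map_eq_zero L₀).2 fun x hx ↦ ?_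
    have h (j : Fin n) : ⟪(b.map B.toLinearEquiv) j, B x⟫ = 0 := by
      simpa [L₀, hb, inner_sub_left] using congrFun hx j
    have hBx : B x = 0 := InnerProductSpace.ext_inner_left_basis (b.map B.toLinearEquiv)
      fun j ↦ by rw [h j, inner_zero_right]
    simpa using hBx
  let L : EuclideanSpace ℝ (Fin n) ≃ₗ[ℝ] (Fin n → ℝ) :=
    LinearEquiv.ofInjectiveOfFinrankEq L₀ hL₀ (by simp)
  obtain ⟨A, a, hA⟩ := exists_linearEquiv_ae_eq_of_ae_comp_eq (μ := volume) T G L c (by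
    filter_upwards [ae_all_iff.2 hc] with x hx
    ext j
    have := hx j
    exact (real_inner_comm _ _).trans (this.trans (congrArg (· + c j) (real_inner_comm _ _))))
  let e := (WithLp.linearEquiv 2 ℝ (Fin n → ℝ)).symm.trans
    (A.trans (WithLp.linearEquiv 2 ℝ (Fin n → ℝ)))
  refine ⟨T.measurable, Matrix.GeneralLinearGroup.toLin.symm
    ((LinearMap.GeneralLinearGroup.generalLinearEquiv ℝ _).symm e), a, hA.mono fun x hx ↦ ?_⟩
  rw [hx]
  congr 1
  have h := Matrix.toLin'_toMatrix' (e : (Fin n → ℝ) →ₗ[ℝ] Fin n → ℝ)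
  exact congrArg (WithLp.toLp 2) (LinearMap.congr_fun h (WithLp.ofLp x)).symm
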